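/- Let $n\ge 2$, let $\mathbb H^n$ be the hyperbolic space of constant curvature $-1$, $\partial_\infty\mathbb H^n$ its asymptotic boundary and $\overline{\mathbb H^n}=\mathbb H^n\cup\partial_\infty\mathbb H^n$ its compactification (in the Poincaré ball model: the open unit ball, the unit sphere and the closed unit ball). For a $C^2$ function $v$ put $Q(v)=-\operatorname{div}\bigl(\nabla v/\sqrt{1+|\nabla v|^2}\bigr)$. Let $f\in C^1(\mathbb H^n\times\mathbb R)$ satisfy $f_t(x,t)\le 0$ for all $(x,t)\in\mathbb H^n\times\mathbb R$ and the following two conditions. (I) For some fixed $o\in\mathbb H^n$ there is a continuous nonincreasing function $\phi:[0,\infty)\to\mathbb R$ with $|f(x,t)|\le\phi(\operatorname{dist}(x,o))$ for all $(x,t)\in\mathbb H^n\times\mathbb R$ and $\int_0^\infty\sqrt{\phi(r)}\,dr<\infty$. (II) There is a continuous function $h:\mathbb R\to\mathbb R$ with $h(t)\to 0$ as $t\to\pm\infty$ and $|f(x,t)|\le h(t)$ for all $(x,t)\in\mathbb H^n\times\mathbb R$. Let $\varphi\in C^0(\partial_\infty\mathbb H^n)$ and $p_1,\dots,p_k\in\partial_\infty\mathbb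 H^n$. If $u\in C^2(\mathbb H^n)\cap C^0\bigl(\overline{\mathbb H^n}\setminus\{p_1,\dots,p_k\}\bigr)$ satisfies $Q(u)(x)=f(x,u(x))$ for all $x\in\mathbb H^n$ and $u=\varphi$ on $\partial_\infty\mathbb H^n\setminus\{p_1,\dots,p_k\}$, then $u$ is bounded. -/

import Mathlib

open Set

noncomputable section

namespace Hyperbolic

/-- Hyperbolic space `ℍⁿ` in the Poincaré ball model: the open Euclidean unit ball, with the
Riemannian metric `riemMetric` below. Being an open subset of `ℝⁿ`, its smooth structure is the
usual one. -/
def space (n : ℕ) : Set (EuclideanSpace ℝ (Fin n)) := Metric.ball 0 1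

/-- The asymptotic boundary `∂_∞ ℍⁿ`: the Euclidean unit sphere. -/
def asymptoticBoundary (n : ℕ) : Set (EuclideanSpace ℝ (Fin n)) := Metric.sphere 0 1

/-- The compactification of `ℍⁿ` by its asymptotic boundary (cone topology): the closed Euclidean
unit ball. -/
def compactification (n : ℕ) : Set (EuclideanSpace ℝ (Fin n)) := Metric.closedBall 0 1

variable {n : ℕ}

/-- The conformal factor `λ(x) = 2 / (1 - |x|²)` of the Poincaré metric. -/
def conformalFactor (x : EuclideanSpace ℝ (Fin n)) : ℝ := 2 / (1 - ‖x‖ ^ 2)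

/-- The Poincaré metric `λ(x)² ⟨v, w⟩` of constant curvature `-1`. -/
def riemMetric (x v w : EuclideanSpace ℝ (Fin n)) : ℝ := conformalFactor x ^ 2 * inner ℝ v w

/-- The Riemannian length of a tangent vector `v` at `x`. -/
def riemNorm (x v : EuclideanSpace ℝ (Fin n)) : ℝ := √(riemMetric x v v)

/-- The hyperbolic distance between two points of the ball. -/
def hypDist (x y : EuclideanSpace ℝ (Fin n)) : ℝ :=
  2 * Real.arsinh (‖x - y‖ / √((1 - ‖x‖ ^ 2) * (1 - ‖y‖ ^ 2)))

/-- The Riemannian gradient `g^{ij} ∂_j u`, that is `λ⁻²` times the Euclidean gradient. -/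
def hypGrad (u : EuclideanSpace ℝ (Fin n) → ℝ) (x : EuclideanSpace ℝ (Fin n)) :
    EuclideanSpace ℝ (Fin n) :=
  (conformalFactor x ^ 2)⁻¹ • gradient u x

/-- The Riemannian divergence `(det g)^{-1/2} ∑ᵢ ∂ᵢ ((det g)^{1/2} Xⁱ)` of a vector field,
where `(det g)^{1/2} = λⁿ`. -/
def hypDiv (X : EuclideanSpace ℝ (Fin n) → EuclideanSpace ℝ (Fin n))
    (x : EuclideanSpace ℝ (Fin n)) : ℝ :=
  (conformalFactor x ^ n)⁻¹ *
    ∑ i : Fin n, fderiv ℝ (fun y => conformalFactor y ^ n * X y i) x (EuclideanSpace.single i 1)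

/-- The operator `Q(u) = -div (∇u / √(1 + |∇u|²))` of hyperbolic space. -/
def Q (u : EuclideanSpace ℝ (Fin n) → ℝ) (x : EuclideanSpace ℝ (Fin n)) : ℝ :=
  -hypDiv (fun y => (√(1 + riemNorm y (hypGrad u y) ^ 2))⁻¹ • hypGrad u y) x

/-- `|f(x,t)| ≤ ϕ(dist(x,o))` for a fixed point `o` and a continuous nonincreasing `ϕ` on
`[0,∞)` whose square root is integrable. -/
def RadialDecay (f : EuclideanSpace ℝ (Fin n) → ℝ → ℝ) : Prop :=
  ∃ o ∈ space n, ∃ ϕ : ℝ → ℝ, ContinuousOn ϕ (Ici 0) ∧ AntitoneOn ϕ (Ici 0) ∧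
    (∀ x ∈ space n, ∀ t : ℝ, |f x t| ≤ ϕ (hypDist x o)) ∧
    MeasureTheory.IntegrableOn (fun r => √(ϕ r)) (Ici 0)

/-- `|f(x,t)| ≤ h(t)` for a continuous `h` that tends to `0` at `±∞`. -/
def HeightDecay (f : EuclideanSpace ℝ (Fin n) → ℝ → ℝ) : Prop :=
  ∃ h : ℝ → ℝ, Continuous h ∧ Filter.Tendsto h Filter.atTop (nhds 0) ∧
    Filter.Tendsto h Filter.atBot (nhds 0) ∧ ∀ x ∈ space n, ∀ t : ℝ, |f x t| ≤ h t

end Hyperbolic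

end

/-! Away from small balls around the `p i`, `u` is continuous on a compact set, so only a one-sided
bound near each ideal point `p` is needed, applied to both `u` and `-u`. For this, cut off `p` by
the geodesic hyperplane orthogonal to the ray towards `p`, at distance `s` from the centre, and let
`d` be the signed distance to it, positive on the side of the centre. The barrier is `M + ψ(d)`,
where `M` bounds `u` on the rest of the boundary and `ψ` is infinite at `d = 1`. If `C` bounds `ψ`
on `[2, ∞)` independently of `s`, then for any given point a large enough `s` puts it in `d ≥ 2` and
yields `u ≤ M + C`.

The uniformity in `s` comes from `|d - s| ≤ dist(0, x)`: near the boundary `|f|` is dominated by `χ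
(d - s)` with `χ` integrable and at most `1/16`, and a translation does not change `∫ χ`. The
profile adds a logarithmic singularity to a bounded corrector absorbing `χ`
(`exists_barrier_profile`). The mean curvature `(n - 1) tanh d ≥ 1/2` of the equidistant
hypersurfaces makes the barrier a strict supersolution. The comparison uses only the touching
principle `Q_le_of_isLocalMax_sub`, and is carried out in `exists_bound_near_ideal_point`. -/

namespace Hyperbolic

variable {n : ℕ}

/-! ### The operator `Q` in ball coordinates. -/

theorem conformalFactor_pos {x : EuclideanSpace ℝ (Fin n)} (hx : x ∈ space n) :
    0 < conformalFactor x := by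
  have h : ‖x‖ < 1 := by simpa [space] using hx
  have h2 : 0 < 1 - ‖x‖ ^ 2 := by nlinarith [norm_nonneg x]
  unfold conformalFactor
  positivity

theorem hasFDerivAt_conformalFactor {x : EuclideanSpace ℝ (Fin n)} (hx : x ∈ space n) :
    HasFDerivAt conformalFactor (conformalFactor x ^ 2 • innerSL ℝ x) x := by
  have h : ‖x‖ < 1 := by simpa [space] using hx
  have h2 : 1 - ‖x‖ ^ 2 ≠ 0 := by nlinarith [norm_nonneg x]
  have h0 := (hasStrictFDerivAt_norm_sq x).hasFDerivAt
  have h1 : HasDerivAt (fun s : ℝ => 2 / (1 - s)) (2 / (1 - ‖x‖ ^ 2) ^ 2) (‖x‖ ^ 2) := by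
    have := ((((hasDerivAt_id (‖x‖ ^ 2)).const_sub 1).fun_inv h2).const_mul 2).congr_deriv
      (g' := 2 / (1 - ‖x‖ ^ 2) ^ 2) (by simp only [id]; ring)
    simpa only [div_eq_mul_inv, id] using this
  have h3 := h1.comp_hasFDerivAt x h0
  refine h3.congr_fderiv ?_
  ext v
  simp [conformalFactor]
  field_simp

theorem gradient_apply (u : EuclideanSpace ℝ (Fin n) → ℝ) (y : EuclideanSpace ℝ (Fin n))
    (i : Fin n) : gradient u y i = fderiv ℝ u y (EuclideanSpace.single i 1) := by
  rw [← inner_gradient_left, EuclideanSpace.inner_single_right]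
  simp

/-- One-variable derivative of the components of `λⁿ ∇u / √(1 + |∇u|²)` along a line. -/
theorem hasDerivAt_flux {l S g : ℝ → ℝ} {l' S' g' t : ℝ} (m : ℕ) (hl : HasDerivAt l l' t)
    (hS : HasDerivAt S S' t) (hg : HasDerivAt g g' t) (hl0 : 0 < l t) (hS0 : 0 ≤ S t) :
    HasDerivAt (fun t => l t ^ m * ((√(1 + S t / l t ^ 2))⁻¹ * ((l t ^ 2)⁻¹ * g t)))
      (l t ^ m * (√(1 + S t / l t ^ 2) ^ 3)⁻¹ *
        (((m - 2) * l' * (l t ^ 3)⁻¹ * g t + (l t ^ 2)⁻¹ * g') * (1 + S t / l t ^ 2)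
          - g t / 2 * (S' * (l t ^ 4)⁻¹ - 2 * S t * l' * (l t ^ 5)⁻¹))) t := by
  have hpos : 0 < 1 + S t / l t ^ 2 := by positivity
  have hW : 0 < √(1 + S t / l t ^ 2) := Real.sqrt_pos.2 hpos
  have h1 := (((hS.div (hl.pow 2) (pow_pos hl0 2).ne').const_add 1).sqrt hpos.ne').inv hW.ne'
  have h2 := (hl.pow m).mul (h1.mul (((hl.pow 2).inv (pow_pos hl0 2).ne').mul hg))
  refine h2.congr_deriv ?_
  simp only [Pi.pow_apply, Pi.inv_apply, Pi.mul_apply, Pi.div_apply]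
  have hsq : √(1 + S t / l t ^ 2) ^ 2 = 1 + S t / l t ^ 2 := Real.sq_sqrt hpos.le
  have hsq' : 1 + S t / l t ^ 2 = √(1 + S t / l t ^ 2) ^ 2 := hsq.symm
  generalize √(1 + S t / l t ^ 2) = W at *
  rw [hsq']
  have hl0' := hl0.ne'
  -- The derivative of `l ^ m` carries the truncated exponent `m - 1`, so `m = 0` is treated apart.
  rcases m with _ | m
  · simp
    field_simp
    ring
  · simp only [Nat.add_sub_cancel]
    push_cast
    rw [pow_succ]
    field_simp
    ring

section
variable (u : EuclideanSpace ℝ (Fin n) → ℝ) (x : EuclideanSpace ℝ (Fin n))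

/-- The Euclidean Hessian as a bilinear form. -/
noncomputable def hess :
    EuclideanSpace ℝ (Fin n) →L[ℝ] EuclideanSpace ℝ (Fin n) →L[ℝ] ℝ :=
  fderiv ℝ (fderiv ℝ u) x

/-- The Euclidean Laplacian. -/
noncomputable def lap : ℝ :=
  ∑ i : Fin n, hess u x (EuclideanSpace.single i 1) (EuclideanSpace.single i 1)

end

theorem bilinear_self_eq_sum
    (E : EuclideanSpace ℝ (Fin n) →L[ℝ] EuclideanSpace ℝ (Fin n) →L[ℝ] ℝ)
    (P : EuclideanSpace ℝ (Fin n)) :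
    E P P = ∑ i, P i *
      ∑ j, P j * E (EuclideanSpace.single i 1) (EuclideanSpace.single j 1) := by
  have hexp : P = ∑ i, P i • EuclideanSpace.single i (1 : ℝ) := by
    ext k
    simp [Finset.sum_apply, Pi.single_apply]
  conv_lhs => rw [hexp]
  simp only [map_sum, map_smul, sum_apply, smul_apply, smul_eq_mul, Finset.mul_sum]
  rw [Finset.sum_comm]
  refine Finset.sum_congr rfl fun i _ => Finset.sum_congr rfl fun j _ => ?_
  ring

/-- Writes `Q` through the Euclidean gradient and Hessian, so that at a point with given gradient it
is affine in the Hessian. -/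
theorem Q_eq {u : EuclideanSpace ℝ (Fin n) → ℝ} {x : EuclideanSpace ℝ (Fin n)}
    (hx : x ∈ space n) (hu : ContDiffAt ℝ 2 u x) :
    Q u x = -((√(1 + ‖gradient u x‖ ^ 2 / conformalFactor x ^ 2) ^ 3)⁻¹ *
      ((((n : ℝ) - 2) * (conformalFactor x)⁻¹ * inner ℝ x (gradient u x)
          + (conformalFactor x ^ 2)⁻¹ * lap u x) * (1 + ‖gradient u x‖ ^ 2 / conformalFactor x ^ 2)
        - (conformalFactor x ^ 4)⁻¹ * hess u x (gradient u x) (gradient u x)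
        + (conformalFactor x ^ 3)⁻¹ * ‖gradient u x‖ ^ 2 * inner ℝ x (gradient u x))) := by
  have hlam := conformalFactor_pos hx
  have hfu : DifferentiableAt ℝ (fderiv ℝ u) x :=
    (hu.fderiv_right (m := 1) (by norm_num)).differentiableAt (by norm_num)
  have hD : HasFDerivAt (fderiv ℝ u) (hess u x) x := hfu.hasFDerivAt
  have hl := hasFDerivAt_conformalFactor hx
  have hcomp : ∀ j : Fin n, HasFDerivAt (fun y => gradient u y j)
      ((hess u x).flip (EuclideanSpace.single j 1)) x := by
    intro j
    simp only [gradient_apply]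
    have := hD.clm_apply (hasFDerivAt_const (EuclideanSpace.single j (1:ℝ)) x)
    refine this.congr_fderiv ?_
    ext v; simp
  have hgradS : HasFDerivAt (fun y => ‖gradient u y‖ ^ 2)
      (∑ j : Fin n, (2 * gradient u x j) • (hess u x).flip (EuclideanSpace.single j 1)) x := by
    simp only [EuclideanSpace.real_norm_sq_eq]
    refine HasFDerivAt.fun_sum fun j _ => ?_
    have := (hcomp j).pow 2
    refine this.congr_fderiv ?_
    ext v; simp
  have hWeq : ∀ y, riemNorm y (hypGrad u y) ^ 2 =
      conformalFactor y ^ 2 * ((conformalFactor y ^ 2)⁻¹ ^ 2 * ‖gradient u y‖ ^ 2) := by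
    intro y
    have : riemMetric y (hypGrad u y) (hypGrad u y) =
        conformalFactor y ^ 2 * ((conformalFactor y ^ 2)⁻¹ ^ 2 * ‖gradient u y‖ ^ 2) := by
      simp only [riemMetric, hypGrad, real_inner_self_eq_norm_sq, norm_smul, mul_pow,
        Real.norm_eq_abs, sq_abs]
    rw [riemNorm, Real.sq_sqrt (by rw [this]; positivity), this]
  have hWeq' : ∀ y, riemNorm y (hypGrad u y) ^ 2 = ‖gradient u y‖ ^ 2 / conformalFactor y ^ 2 := by
    intro y
    rw [hWeq]
    by_cases h0 : conformalFactor y = 0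
    · simp [h0]
    · field_simp
  have key : ∀ i : Fin n, fderiv ℝ (fun y => conformalFactor y ^ n *
      ((√(1 + riemNorm y (hypGrad u y) ^ 2))⁻¹ • hypGrad u y) i) x (EuclideanSpace.single i 1) =
      conformalFactor x ^ n * (√(1 + ‖gradient u x‖ ^ 2 / conformalFactor x ^ 2) ^ 3)⁻¹ *
        (((n - 2) * (conformalFactor x ^ 2 * x i) * (conformalFactor x ^ 3)⁻¹ * gradient u x i
            + (conformalFactor x ^ 2)⁻¹ *
              hess u x (EuclideanSpace.single i 1) (EuclideanSpace.single i 1)) *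
              (1 + ‖gradient u x‖ ^ 2 / conformalFactor x ^ 2)
          - gradient u x i / 2 *
            ((∑ j, 2 * gradient u x j * hess u x (EuclideanSpace.single i 1)
                (EuclideanSpace.single j 1)) * (conformalFactor x ^ 4)⁻¹
              - 2 * ‖gradient u x‖ ^ 2 * (conformalFactor x ^ 2 * x i)
                * (conformalFactor x ^ 5)⁻¹)) := by
    intro i
    set e : EuclideanSpace ℝ (Fin n) := EuclideanSpace.single i 1 with he
    have hfun : (fun y => conformalFactor y ^ n *
        ((√(1 + riemNorm y (hypGrad u y) ^ 2))⁻¹ • hypGrad u y) i) =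
        fun y => conformalFactor y ^ n * ((√(1 + ‖gradient u y‖ ^ 2 / conformalFactor y ^ 2))⁻¹ *
          ((conformalFactor y ^ 2)⁻¹ * gradient u y i)) := by
      ext y
      rw [hWeq']
      simp [hypGrad]
    rw [hfun]
    have hne : (1 + ‖gradient u x‖ ^ 2 / conformalFactor x ^ 2) ≠ 0 := by positivity
    have hd : DifferentiableAt ℝ (fun y => conformalFactor y ^ n *
        ((√(1 + ‖gradient u y‖ ^ 2 / conformalFactor y ^ 2))⁻¹ *
          ((conformalFactor y ^ 2)⁻¹ * gradient u y i))) x := by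
      have a1 := hl.differentiableAt
      have a2 := hgradS.differentiableAt
      have a3 := (hcomp i).differentiableAt
      have a4 := a1.fun_pow 2
      have a5 : DifferentiableAt ℝ (fun y => √(1 + ‖gradient u y‖ ^ 2 / conformalFactor y ^ 2)) x := by
        simp only [div_eq_mul_inv] at hne ⊢
        exact ((a2.fun_mul (a4.fun_inv (pow_pos hlam 2).ne')).const_add 1).sqrt hne
      exact (a1.fun_pow n).fun_mul ((a5.fun_inv (by positivity)).fun_mul
        ((a4.fun_inv (pow_pos hlam 2).ne').fun_mul a3))
    -- Restriction to the line `x + t e` turns the partial derivative into the one-variable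
    -- `hasDerivAt_flux`.
    have h1 : HasDerivAt (fun t : ℝ => conformalFactor (x + t • e)) (conformalFactor x ^ 2 * x i)
        0 := by
      have := hl.hasLineDerivAt e
      simpa [HasLineDerivAt, he, EuclideanSpace.inner_single_right] using this
    have h2 := hgradS.hasLineDerivAt e
    have h3 := (hcomp i).hasLineDerivAt e
    have h4 := hasDerivAt_flux n h1 h2 h3 (by simpa using hlam) (by positivity)
    have h5 := (hd.hasFDerivAt.hasLineDerivAt e)
    rw [h5.unique h4]
    simp [he, ContinuousLinearMap.flip_apply]
  rw [Q, hypDiv]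
  simp only [key]
  rw [← Finset.mul_sum]
  have hlap : lap u x = ∑ i : Fin n, hess u x (EuclideanSpace.single i 1)
    (EuclideanSpace.single i 1) := rfl
  have hinner : inner ℝ x (gradient u x) = ∑ i, x i * gradient u x i := by
    rw [PiLp.inner_apply]
    exact Finset.sum_congr rfl fun i _ => mul_comm _ _
  have hH := bilinear_self_eq_sum (hess u x) (gradient u x)
  rw [hlap, hinner, hH]
  rw [mul_assoc, ← mul_assoc _ (conformalFactor x ^ n), inv_mul_cancel₀ (by positivity), one_mul]
  congr 2
  simp only [Finset.mul_sum, Finset.sum_mul, ← Finset.sum_add_distrib, ← Finset.sum_sub_distrib,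
    add_mul, mul_add]
  generalize conformalFactor x = l at *
  generalize ‖gradient u x‖ = S
  have hl' := hlam.ne'
  refine Finset.sum_congr rfl fun i _ => ?_
  simp only [mul_sub, Finset.mul_sum]
  have : ∀ j, gradient u x i / 2 * (2 * gradient u x j * hess u x (EuclideanSpace.single i 1)
      (EuclideanSpace.single j 1) * (l ^ 4)⁻¹) = (l ^ 4)⁻¹ * (gradient u x i * (gradient u x j *
      hess u x (EuclideanSpace.single i 1) (EuclideanSpace.single j 1))) := by
    intro j; ring
  simp only [this]
  generalize ∑ j, (l ^ 4)⁻¹ * (gradient u x i * (gradient u x j *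
      hess u x (EuclideanSpace.single i 1) (EuclideanSpace.single j 1))) = A
  field_simp
  ring

/-! ### The touching principle. -/

theorem differentiableAt_fderiv {u : EuclideanSpace ℝ (Fin n) → ℝ} {x : EuclideanSpace ℝ (Fin n)}
    (hu : ContDiffAt ℝ 2 u x) : DifferentiableAt ℝ (fderiv ℝ u) x :=
  (hu.fderiv_right (m := 1) (by norm_num)).differentiableAt (by norm_num)

theorem eventually_differentiableAt {u : EuclideanSpace ℝ (Fin n) → ℝ}
    {x : EuclideanSpace ℝ (Fin n)} (hu : ContDiffAt ℝ 2 u x) :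
    ∀ᶠ y in nhds x, DifferentiableAt ℝ u y :=
  (hu.eventually (by simp)).mono fun _ h => h.differentiableAt (by norm_num)

/-- Second order necessary condition at a local maximum. -/
theorem hess_nonpos_of_isLocalMax {v : EuclideanSpace ℝ (Fin n) → ℝ}
    {x : EuclideanSpace ℝ (Fin n)} (hv : ContDiffAt ℝ 2 v x) (hmax : IsLocalMax v x)
    (ξ : EuclideanSpace ℝ (Fin n)) : hess v x ξ ξ ≤ 0 := by
  set γ : ℝ → EuclideanSpace ℝ (Fin n) := fun t => x + t • ξ with hγ
  have hγ0 : γ 0 = x := by simp [hγ]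
  have hγd : ∀ t, HasDerivAt γ ξ t := fun t => by
    simpa [hγ] using ((hasDerivAt_id t).smul_const ξ).const_add x
  have hγc : Filter.Tendsto γ (nhds 0) (nhds x) := by
    have := (hγd 0).continuousAt.tendsto
    rwa [hγ0] at this
  set g : ℝ → ℝ := fun t => v (γ t) with hg
  have hd : deriv g =ᶠ[nhds 0] fun t => fderiv ℝ v (γ t) ξ :=
    (hγc.eventually (eventually_differentiableAt hv)).mono fun t ht =>
      (ht.hasFDerivAt.comp_hasDerivAt t (hγd t)).deriv
  have hdd : deriv (deriv g) 0 = hess v x ξ ξ := by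
    rw [hd.deriv_eq]
    have h1 : HasFDerivAt (fderiv ℝ v) (hess v x) (γ 0) := by
      rw [hγ0]; exact (differentiableAt_fderiv hv).hasFDerivAt
    exact ((h1.comp_hasDerivAt 0 (hγd 0)).clm_apply (hasDerivAt_const 0 ξ)).deriv.trans (by simp)
  have hd0 : deriv g 0 = 0 := by
    rw [hd.self_of_nhds]
    simp only [hγ0, hmax.fderiv_eq_zero, zero_apply]
  have hgmax : IsLocalMax g 0 := by
    have : ∀ᶠ y in nhds x, v y ≤ v x := hmax
    have := hγc.eventually this
    simpa only [IsLocalMax, IsMaxFilter, hg, hγ0] using this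
  by_contra! hpos
  have hcont : ContinuousAt g 0 :=
    ContinuousAt.comp (by rw [hγ0]; exact hv.continuousAt) (hγd 0).continuousAt
  -- A positive second derivative makes `0` also a local minimum of `g`, so `g` is locally constant,
  -- contradicting that positivity.
  have hmin := isLocalMin_of_deriv_deriv_pos (by rw [hdd]; exact hpos) hd0 hcont
  have heq : g =ᶠ[nhds 0] fun _ => g 0 := by
    filter_upwards [hgmax, hmin] with t h1 h2 using le_antisymm h1 h2
  have : deriv (deriv g) 0 = 0 := by
    rw [heq.deriv.deriv_eq]
    simp
  linarith [hdd]

/-- `|P|² tr E ≤ E(P, P)` for a negative semidefinite form. -/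
theorem norm_sq_mul_trace_le
    (E : EuclideanSpace ℝ (Fin n) →L[ℝ] EuclideanSpace ℝ (Fin n) →L[ℝ] ℝ)
    (hE : ∀ ξ, E ξ ξ ≤ 0) (P : EuclideanSpace ℝ (Fin n)) :
    ‖P‖ ^ 2 * ∑ i : Fin n, E (EuclideanSpace.single i 1) (EuclideanSpace.single i 1) ≤ E P P := by
  set b : Fin n → EuclideanSpace ℝ (Fin n) := fun i => EuclideanSpace.single i 1 with hb
  have hEP : E P P = ∑ i, ∑ j, P i * P j * E (b i) (b j) := by
    rw [bilinear_self_eq_sum]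
    simp only [Finset.mul_sum, ← mul_assoc]
    rfl
  have hS : ‖P‖ ^ 2 * ∑ i, E (b i) (b i) = ∑ i, ∑ j, P i ^ 2 * E (b j) (b j) := by
    rw [EuclideanSpace.real_norm_sq_eq, Finset.sum_mul_sum]
  have hpt : ∑ i, ∑ j, (P i ^ 2 * E (b j) (b j) + P j ^ 2 * E (b i) (b i)
      - P i * P j * E (b i) (b j) - P j * P i * E (b j) (b i)) ≤ 0 := by
    refine Finset.sum_nonpos fun i _ => Finset.sum_nonpos fun j _ => ?_
    -- Summed over `i, j` this gives `2 (|P|² tr E - E(P, P)) ≤ 0`; the double sum symmetrises, so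
    -- `E` need not be symmetric.
    have := hE (P i • b j - P j • b i)
    simp only [map_sub, map_smul, sub_apply, smul_apply, smul_eq_mul] at this
    linarith
  simp only [Finset.sum_sub_distrib, Finset.sum_add_distrib] at hpt
  have h1 : ∑ i, ∑ j, P j ^ 2 * E (b i) (b i) = ∑ i, ∑ j, P i ^ 2 * E (b j) (b j) :=
    Finset.sum_comm
  have h2 : ∑ i, ∑ j, P j * P i * E (b j) (b i) = ∑ i, ∑ j, P i * P j * E (b i) (b j) :=
    Finset.sum_comm
  change ‖P‖ ^ 2 * ∑ i, E (b i) (b i) ≤ E P P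
  rw [hS, hEP]
  linarith

/-- Touching principle: at an interior maximum of `u - w` one has `Q w ≤ Q u`. -/
theorem Q_le_of_isLocalMax_sub {u w : EuclideanSpace ℝ (Fin n) → ℝ}
    {x : EuclideanSpace ℝ (Fin n)} (hx : x ∈ space n) (hu : ContDiffAt ℝ 2 u x)
    (hw : ContDiffAt ℝ 2 w x) (hmax : IsLocalMax (fun y => u y - w y) x) : Q w x ≤ Q u x := by
  have hlam := conformalFactor_pos hx
  have hv : ContDiffAt ℝ 2 (fun y => u y - w y) x := hu.sub hw
  have hfd : fderiv ℝ (fun y => u y - w y) =ᶠ[nhds x] fun y => fderiv ℝ u y - fderiv ℝ w y := by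
    filter_upwards [eventually_differentiableAt hu, eventually_differentiableAt hw] with y h1 h2
    exact fderiv_fun_sub h1 h2
  have hgrad : gradient u x = gradient w x := by
    have h := hfd.self_of_nhds
    rw [hmax.fderiv_eq_zero] at h
    simp only [gradient]
    rw [sub_eq_zero.1 h.symm]
  have hhess : hess (fun y => u y - w y) x = hess u x - hess w x := by
    unfold hess
    rw [hfd.fderiv_eq]
    exact fderiv_fun_sub (differentiableAt_fderiv hu) (differentiableAt_fderiv hw)
  have hneg := hess_nonpos_of_isLocalMax hv hmax
  have htr := norm_sq_mul_trace_le _ hneg (gradient w x)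
  have hlapneg : lap u x - lap w x ≤ 0 := by
    rw [lap, lap, ← Finset.sum_sub_distrib]
    refine Finset.sum_nonpos fun i _ => ?_
    simpa [hhess] using hneg (EuclideanSpace.single i 1)
  rw [hhess] at htr
  simp only [sub_apply, Finset.sum_sub_distrib] at htr
  change _ * (lap u x - lap w x) ≤ _ at htr
  rw [Q_eq hx hu, Q_eq hx hw, hgrad]
  -- The gradients agree, so only second-order terms differ: the trace part is controlled by
  -- `hlapneg`, the part weighted by `|∇w|²` by `htr`.
  refine neg_le_neg (mul_le_mul_of_nonneg_left ?_ (by positivity))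
  generalize hess u x _ _ = H1 at *
  generalize hess w x _ _ = H2 at *
  generalize conformalFactor x = l at *
  have h3 : (l ^ 2)⁻¹ * (lap u x - lap w x) ≤ 0 :=
    mul_nonpos_of_nonneg_of_nonpos (by positivity) hlapneg
  have h4 := mul_le_mul_of_nonneg_left htr (by positivity : 0 ≤ (l ^ 4)⁻¹)
  have h5 : (l ^ 2)⁻¹ * (‖gradient w x‖ ^ 2 / l ^ 2) = (l ^ 4)⁻¹ * ‖gradient w x‖ ^ 2 := by
    field_simp
  have h6 : (l ^ 2)⁻¹ * (lap u x - lap w x) * (‖gradient w x‖ ^ 2 / l ^ 2) =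
      (l ^ 4)⁻¹ * (‖gradient w x‖ ^ 2 * (lap u x - lap w x)) := by
    rw [mul_right_comm, h5]; ring
  nlinarith

theorem Q_neg (u : EuclideanSpace ℝ (Fin n) → ℝ) (x : EuclideanSpace ℝ (Fin n)) :
    Q (fun y => -u y) x = -Q u x := by
  have hg : ∀ y, gradient (fun y => -u y) y = -gradient u y := fun y => by
    simp only [gradient, fderiv_fun_neg, map_neg]
  have hn : ∀ y, riemNorm y (hypGrad (fun y => -u y) y) = riemNorm y (hypGrad u y) := fun y => by
    simp [riemNorm, riemMetric, hypGrad, hg]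
  simp only [Q, hypDiv, hn]
  simp only [hypGrad, hg, smul_neg, PiLp.neg_apply, mul_neg, fderiv_fun_neg, neg_apply,
    Finset.sum_neg_distrib]

/-! ### Signed distance to a geodesic hyperplane. -/

/-- The hyperbolic sine of the signed distance to the totally geodesic hyperplane orthogonal to the
ray from `0` to the ideal point `p`, at distance `s` from `0`; positive at `0` if `0 < s`. -/
noncomputable def planeSinh (s : ℝ) (p x : EuclideanSpace ℝ (Fin n)) : ℝ :=
  conformalFactor x * (Real.sinh s - Real.cosh s * inner ℝ p x) - Real.sinh s

theorem hasFDerivAt_planeSinh (s : ℝ) (p : EuclideanSpace ℝ (Fin n))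
    {x : EuclideanSpace ℝ (Fin n)} (hx : x ∈ space n) :
    HasFDerivAt (planeSinh s p) ((conformalFactor x * (planeSinh s p x + Real.sinh s)) • innerSL ℝ x
      - (conformalFactor x * Real.cosh s) • innerSL ℝ p) x := by
  have h := (hasFDerivAt_conformalFactor hx).mul
    ((((innerSL ℝ p).hasFDerivAt (x := x)).const_mul (Real.cosh s)).const_sub (Real.sinh s))
  refine (h.sub_const (Real.sinh s)).congr_fderiv ?_
  ext v
  simp [planeSinh]
  ring

theorem contDiffAt_conformalFactor {x : EuclideanSpace ℝ (Fin n)} (hx : x ∈ space n) :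
    ContDiffAt ℝ 2 conformalFactor x := by
  have h : ‖x‖ < 1 := by simpa [space] using hx
  have h2 : 1 - ‖x‖ ^ 2 ≠ 0 := by nlinarith [norm_nonneg x]
  exact contDiffAt_const.div (contDiffAt_const.sub (contDiff_norm_sq ℝ).contDiffAt) h2

theorem contDiffAt_planeSinh (s : ℝ) (p : EuclideanSpace ℝ (Fin n))
    {x : EuclideanSpace ℝ (Fin n)} (hx : x ∈ space n) : ContDiffAt ℝ 2 (planeSinh s p) x :=
  ((contDiffAt_conformalFactor hx).mul (contDiffAt_const.sub
    (contDiffAt_const.mul (contDiffAt_const.inner ℝ contDiffAt_id)))).sub contDiffAt_const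

theorem isOpen_space : IsOpen (space n) := Metric.isOpen_ball

theorem gradient_planeSinh (s : ℝ) (p : EuclideanSpace ℝ (Fin n))
    {x : EuclideanSpace ℝ (Fin n)} (hx : x ∈ space n) :
    gradient (planeSinh s p) x = (conformalFactor x * (planeSinh s p x + Real.sinh s)) • x
      - (conformalFactor x * Real.cosh s) • p := by
  rw [gradient, (hasFDerivAt_planeSinh s p hx).fderiv, LinearIsometryEquiv.symm_apply_eq]
  ext v
  simp

/-- In the hyperboloid model `planeSinh` is the restriction of a linear function, so its Riemannian
Hessian is itself times the metric. This is the Euclidean form of that fact; the mixed terms are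
Christoffel terms of the conformal metric. -/
theorem hess_planeSinh (s : ℝ) (p : EuclideanSpace ℝ (Fin n))
    {x : EuclideanSpace ℝ (Fin n)} (hx : x ∈ space n) (ξ η : EuclideanSpace ℝ (Fin n)) :
    hess (planeSinh s p) x ξ η =
      conformalFactor x * (planeSinh s p x + Real.sinh s) * inner ℝ ξ η +
      conformalFactor x * (inner ℝ x ξ * inner ℝ (gradient (planeSinh s p) x) η +
        inner ℝ x η * inner ℝ (gradient (planeSinh s p) x) ξ) := by
  have hev : fderiv ℝ (planeSinh s p) =ᶠ[nhds x] fun y =>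
      (conformalFactor y * (planeSinh s p y + Real.sinh s)) • innerSL ℝ y
      - (conformalFactor y * Real.cosh s) • innerSL ℝ p :=
    Filter.Eventually.mono (isOpen_space.mem_nhds hx) fun y hy => (hasFDerivAt_planeSinh s p hy).fderiv
  have hl := hasFDerivAt_conformalFactor hx
  have h1 := (hl.mul ((hasFDerivAt_planeSinh s p hx).add_const (Real.sinh s))).smul
    ((innerSL ℝ (E := EuclideanSpace ℝ (Fin n))).hasFDerivAt (x := x))
  have h2 := (hl.mul_const (Real.cosh s)).smul_const (innerSL ℝ p)
  rw [hess, hev.fderiv_eq]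
  have h3 := (h1.sub h2).fderiv
  refine (congrArg (fun L => L ξ η) h3).trans ?_
  rw [gradient_planeSinh s p hx]
  change (conformalFactor x * (planeSinh s p x + Real.sinh s)) * inner ℝ ξ η +
    (conformalFactor x * ((conformalFactor x * (planeSinh s p x + Real.sinh s)) * inner ℝ x ξ
        - (conformalFactor x * Real.cosh s) * inner ℝ p ξ)
      + (planeSinh s p x + Real.sinh s) * (conformalFactor x ^ 2 * inner ℝ x ξ)) * inner ℝ x η
    - (Real.cosh s * (conformalFactor x ^ 2 * inner ℝ x ξ)) * inner ℝ p η = _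
  simp only [inner_sub_left, real_inner_smul_left]
  ring

theorem inner_gradient_planeSinh (s : ℝ) (p : EuclideanSpace ℝ (Fin n))
    {x : EuclideanSpace ℝ (Fin n)} (hx : x ∈ space n) :
    inner ℝ x (gradient (planeSinh s p) x) =
      conformalFactor x * planeSinh s p x - (planeSinh s p x + Real.sinh s) := by
  have h : ‖x‖ < 1 := by simpa [space] using hx
  have h2 : 1 - ‖x‖ ^ 2 ≠ 0 := by nlinarith [norm_nonneg x]
  rw [gradient_planeSinh s p hx, inner_sub_right, inner_smul_right, inner_smul_right,
    real_inner_self_eq_norm_sq, real_inner_comm]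
  simp only [planeSinh, conformalFactor]
  field_simp
  ring

/-- Expresses that `arsinh` of `planeSinh` has Riemannian gradient of length one. -/
theorem norm_sq_gradient_planeSinh (s : ℝ) {p : EuclideanSpace ℝ (Fin n)} (hp : ‖p‖ = 1)
    {x : EuclideanSpace ℝ (Fin n)} (hx : x ∈ space n) :
    ‖gradient (planeSinh s p) x‖ ^ 2 = conformalFactor x ^ 2 * (1 + planeSinh s p x ^ 2) := by
  have h : ‖x‖ < 1 := by simpa [space] using hx
  have h2 : 1 - ‖x‖ ^ 2 ≠ 0 := by nlinarith [norm_nonneg x]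
  have hc := Real.cosh_sq s
  rw [gradient_planeSinh s p hx, norm_sub_sq_real, norm_smul, norm_smul, mul_pow, mul_pow, hp,
    real_inner_smul_left, real_inner_smul_right, Real.norm_eq_abs, Real.norm_eq_abs, sq_abs, sq_abs,
    real_inner_comm]
  simp only [planeSinh, conformalFactor]
  field_simp
  ring_nf
  simp only [hc]
  ring

section Composition

variable {σ : EuclideanSpace ℝ (Fin n) → ℝ} {x : EuclideanSpace ℝ (Fin n)} {F F1 : ℝ → ℝ} {F2 : ℝ}

theorem gradient_comp (hσ : ContDiffAt ℝ 2 σ x) (hF : HasDerivAt F (F1 (σ x)) (σ x)) :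
    gradient (fun y => F (σ y)) x = F1 (σ x) • gradient σ x := by
  have h := hF.comp_hasFDerivAt x (hσ.differentiableAt (by norm_num)).hasFDerivAt
  rw [gradient, gradient, ← map_smul]
  exact congrArg _ h.fderiv

theorem hess_comp (hσ : ContDiffAt ℝ 2 σ x) (hF : ∀ᶠ z in nhds (σ x), HasDerivAt F (F1 z) z)
    (hF1 : HasDerivAt F1 F2 (σ x)) (ξ η : EuclideanSpace ℝ (Fin n)) :
    hess (fun y => F (σ y)) x ξ η =
      F2 * inner ℝ (gradient σ x) ξ * inner ℝ (gradient σ x) η + F1 (σ x) * hess σ x ξ η := by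
  have hev : fderiv ℝ (fun y => F (σ y)) =ᶠ[nhds x] fun y => F1 (σ y) • fderiv ℝ σ y := by
    filter_upwards [hσ.continuousAt.eventually hF, eventually_differentiableAt hσ] with y h1 h2
    exact (h1.comp_hasFDerivAt y h2.hasFDerivAt).fderiv
  have h1 := hF1.comp_hasFDerivAt x (hσ.differentiableAt (by norm_num)).hasFDerivAt
  have h2 := h1.smul (differentiableAt_fderiv hσ).hasFDerivAt
  rw [hess, hev.fderiv_eq]
  refine (congrArg (fun L => L ξ η) h2.fderiv).trans ?_
  simp [inner_gradient_left, hess]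
  ring

end Composition

theorem lap_planeSinh (s : ℝ) (p : EuclideanSpace ℝ (Fin n))
    {x : EuclideanSpace ℝ (Fin n)} (hx : x ∈ space n) :
    lap (planeSinh s p) x = n * (conformalFactor x * (planeSinh s p x + Real.sinh s)) +
      2 * conformalFactor x * inner ℝ x (gradient (planeSinh s p) x) := by
  simp only [lap, hess_planeSinh s p hx]
  rw [Finset.sum_add_distrib, ← Finset.mul_sum, ← Finset.mul_sum, Finset.sum_add_distrib]
  have h1 : ∑ i : Fin n, inner ℝ (EuclideanSpace.single i (1 : ℝ)) (EuclideanSpace.single i (1 : ℝ))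
      = (n : ℝ) := by
    simp
  have h2 : ∀ v : EuclideanSpace ℝ (Fin n), ∑ i : Fin n, inner ℝ x (EuclideanSpace.single i (1 : ℝ))
      * inner ℝ v (EuclideanSpace.single i (1 : ℝ)) = inner ℝ x v := fun v => by
    rw [PiLp.inner_apply]
    exact Finset.sum_congr rfl fun i _ => by
      simp only [EuclideanSpace.inner_single_right]; simp [mul_comm]
  rw [h1, h2]
  ring

/-- `Q` on functions of the signed distance to a totally geodesic hyperplane. -/
theorem Q_comp_planeSinh (s : ℝ) {p : EuclideanSpace ℝ (Fin n)} (hp : ‖p‖ = 1)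
    {x : EuclideanSpace ℝ (Fin n)} (hx : x ∈ space n) {F F1 : ℝ → ℝ} {F2 : ℝ}
    (hFc : ContDiffAt ℝ 2 F (planeSinh s p x))
    (hF : ∀ᶠ z in nhds (planeSinh s p x), HasDerivAt F (F1 z) z)
    (hF1 : HasDerivAt F1 F2 (planeSinh s p x)) :
    Q (fun y => F (planeSinh s p y)) x =
      -((√(1 + F1 (planeSinh s p x) ^ 2 * (1 + planeSinh s p x ^ 2)) ^ 3)⁻¹ *
        (F2 * (1 + planeSinh s p x ^ 2) + n * planeSinh s p x * F1 (planeSinh s p x)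
          + (n - 1) * F1 (planeSinh s p x) ^ 3 * planeSinh s p x * (1 + planeSinh s p x ^ 2))) := by
  have hlam := conformalFactor_pos hx
  have hσ := contDiffAt_planeSinh s p hx
  have hX := inner_gradient_planeSinh s p hx
  have hS := norm_sq_gradient_planeSinh s hp hx
  have hlap : lap (fun y => F (planeSinh s p y)) x = F2 * ‖gradient (planeSinh s p) x‖ ^ 2 +
      F1 (planeSinh s p x) * lap (planeSinh s p) x := by
    simp only [lap, hess_comp hσ hF hF1]
    rw [Finset.sum_add_distrib, ← Finset.mul_sum, EuclideanSpace.real_norm_sq_eq]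
    refine congrArg₂ (· + ·) ?_ rfl
    rw [Finset.mul_sum]
    refine Finset.sum_congr rfl fun i _ => ?_
    rw [EuclideanSpace.inner_single_right]
    simp only [one_mul, conj_trivial]
    ring
  rw [Q_eq (u := fun y => F (planeSinh s p y)) hx (hFc.comp x hσ), hlap, lap_planeSinh s p hx, gradient_comp hσ hF.self_of_nhds,
    hess_comp hσ hF hF1, hess_planeSinh s p hx, norm_smul, mul_pow, Real.norm_eq_abs, sq_abs]
  simp only [inner_smul_right, inner_smul_left, real_inner_self_eq_norm_sq, hS, hX]
  generalize planeSinh s p x = σ at *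
  generalize conformalFactor x = l at *
  generalize F1 σ = q
  have e : q ^ 2 * (l ^ 2 * (1 + σ ^ 2)) / l ^ 2 = q ^ 2 * (1 + σ ^ 2) := by field_simp
  rw [e]
  congr 2
  simp
  field_simp
  ring

/-! ### The one-dimensional barrier profile. -/

/-- A bounded nondecreasing solution of `B'' = -B' / 2 + 2 g` on `[1, ∞)`. -/
theorem exists_bounded_corrector {g : ℝ → ℝ} (hg : Continuous g) (hg0 : ∀ y, 0 ≤ g y)
    (hgi : MeasureTheory.Integrable g) :
    ∃ B G : ℝ → ℝ, (∀ d, HasDerivAt B (G d) d) ∧ (∀ d, HasDerivAt G (-G d / 2 + 2 * g d) d) ∧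
      ∀ d, 1 ≤ d → 0 ≤ G d ∧ 0 ≤ B d ∧ B d ≤ 4 * ∫ y, g y := by
  set Φ : ℝ → ℝ := fun d => ∫ τ in (1 : ℝ)..d, g τ with hΦ
  have hΦd : ∀ d, HasDerivAt Φ (g d) d := fun d => (hg.integral_hasStrictDerivAt 1 d).hasDerivAt
  have hΦc : Continuous Φ := continuous_iff_continuousAt.2 fun d => (hΦd d).continuousAt
  have hΦm : Monotone Φ := monotone_of_deriv_nonneg (fun d => (hΦd d).differentiableAt)
    fun d => by rw [(hΦd d).deriv]; exact hg0 d
  have hΦ0 : ∀ d, 1 ≤ d → 0 ≤ Φ d := fun d hd => by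
    have := hΦm hd
    simpa [hΦ] using this
  have hΦI : ∀ d, 1 ≤ d → Φ d ≤ ∫ y, g y := fun d hd => by
    rw [hΦ]
    simp only
    rw [intervalIntegral.integral_of_le hd]
    exact MeasureTheory.setIntegral_le_integral hgi (Filter.Eventually.of_forall hg0)
  have hkc : Continuous fun τ => Real.exp (τ / 2) * (2 * Φ τ) := by fun_prop
  set J : ℝ → ℝ := fun d => ∫ τ in (1 : ℝ)..d, Real.exp (τ / 2) * (2 * Φ τ) with hJ
  have hJd : ∀ d, HasDerivAt J (Real.exp (d / 2) * (2 * Φ d)) d :=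
    fun d => (hkc.integral_hasStrictDerivAt 1 d).hasDerivAt
  have hJ0 : ∀ d, 1 ≤ d → 0 ≤ J d := fun d hd =>
    intervalIntegral.integral_nonneg hd fun t ht =>
      mul_nonneg (Real.exp_pos _).le (mul_nonneg (by norm_num) (hΦ0 t ht.1))
  -- Replacing the increasing `Φ` by its final value gives `B ≤ 4 Φ` for `B = exp (-d / 2) J`. As `G
  -- = -B / 2 + 2 Φ`, this yields both the bound on `B` and `0 ≤ G`.
  have hJle : ∀ d, 1 ≤ d → J d ≤ Real.exp (d / 2) * (4 * Φ d) := fun d hd => by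
    have hd1 : ∀ t ∈ uIcc 1 d, HasDerivAt (fun t => Real.exp (t / 2) * (4 * Φ d))
        (Real.exp (t / 2) * (2 * Φ d)) t := fun t _ => by
      have := ((Real.hasDerivAt_exp (t / 2)).comp t ((hasDerivAt_id t).div_const 2)).mul_const
        (4 * Φ d)
      refine this.congr_deriv ?_
      ring
    have h1 : J d ≤ ∫ τ in (1 : ℝ)..d, Real.exp (τ / 2) * (2 * Φ d) :=
      intervalIntegral.integral_mono_on hd (hkc.intervalIntegrable _ _)
        ((by fun_prop : Continuous fun τ => Real.exp (τ / 2) * (2 * Φ d)).intervalIntegrable _ _)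
        fun t ht => mul_le_mul_of_nonneg_left
          (mul_le_mul_of_nonneg_left (hΦm ht.2) (by norm_num)) (Real.exp_pos _).le
    rw [intervalIntegral.integral_eq_sub_of_hasDerivAt hd1
      ((by fun_prop : Continuous fun τ => Real.exp (τ / 2) * (2 * Φ d)).intervalIntegrable _ _)] at h1
    have := mul_nonneg (Real.exp_pos (1 / 2)).le (mul_nonneg (by norm_num : (0 : ℝ) ≤ 4) (hΦ0 d hd))
    linarith
  have hed : ∀ d : ℝ, HasDerivAt (fun t => Real.exp (-t / 2)) (-(Real.exp (-d / 2)) / 2) d :=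
    fun d => by
      have := (Real.hasDerivAt_exp (-d / 2)).comp d (((hasDerivAt_id d).neg).div_const 2)
      refine this.congr_deriv ?_
      ring
  have hee : ∀ d : ℝ, Real.exp (-d / 2) * Real.exp (d / 2) = 1 := fun d => by
    rw [← Real.exp_add, ← Real.exp_zero]; congr 1; ring
  have hB : ∀ d, HasDerivAt (fun t => Real.exp (-t / 2) * J t)
      (-(Real.exp (-d / 2) * J d) / 2 + 2 * Φ d) d := fun d => by
    refine ((hed d).mul (hJd d)).congr_deriv ?_
    have := hee d
    linear_combination (2 * Φ d) * this
  refine ⟨fun d => Real.exp (-d / 2) * J d, fun d => -(Real.exp (-d / 2) * J d) / 2 + 2 * Φ d,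
    hB, fun d => ?_, fun d hd => ?_⟩
  · refine (((hB d).neg.div_const 2).add ((hΦd d).const_mul 2)).congr_deriv ?_
    ring
  · have h1 := mul_le_mul_of_nonneg_left (hJle d hd) (Real.exp_pos (-d / 2)).le
    rw [← mul_assoc, hee, one_mul] at h1
    have h2 := hΦI d hd
    refine ⟨?_, mul_nonneg (Real.exp_pos _).le (hJ0 d hd), ?_⟩
    · simp only; linarith
    · simp only; linarith

theorem contDiff_two_of_hasDerivAt {f f1 f2 : ℝ → ℝ} (h : ∀ d, HasDerivAt f (f1 d) d)
    (h1 : ∀ d, HasDerivAt f1 (f2 d) d) (h2 : Continuous f2) : ContDiff ℝ 2 f := by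
  have e : deriv f = f1 := funext fun d => (h d).deriv
  have e1 : deriv f1 = f2 := funext fun d => (h1 d).deriv
  rw [show (2 : WithTop ℕ∞) = 1 + 1 from by norm_num, contDiff_succ_iff_deriv]
  refine ⟨fun d => (h d).differentiableAt, by simp, ?_⟩
  rw [e, contDiff_one_iff_deriv, e1]
  exact ⟨fun d => (h1 d).differentiableAt, h2⟩

theorem sqrt_one_add_sq_pow_three_le {G : ℝ} (hG : 0 ≤ G) : √(1 + G ^ 2) ^ 3 ≤ 2 * (1 + G ^ 3) := by
  have h1 : √(1 + G ^ 2) ≤ 1 + G := Real.sqrt_le_iff.2 ⟨by linarith, by nlinarith⟩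
  have h2 : √(1 + G ^ 2) ^ 2 = 1 + G ^ 2 := Real.sq_sqrt (by positivity)
  rw [pow_succ, h2]
  have := mul_le_mul_of_nonneg_left h1 (by positivity : 0 ≤ 1 + G ^ 2)
  nlinarith [mul_nonneg (sq_nonneg (1 - G)) (by linarith : 0 ≤ 1 + G)]

/-- The pointwise inequality making the barrier a strict supersolution. -/
theorem barrier_ineq {G H χ τ : ℝ} (hG : 0 ≤ G) (hH : 0 < H) (hχ : 0 ≤ χ) (hχ' : χ ≤ 1 / 16)
    (hτ : 1 / 2 ≤ τ) :
    -(-G / 2 + 2 * χ) + (H + H ^ 2) / 4 + τ * ((-G - H) + (-G - H) ^ 3) <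
      -(χ * √(1 + (-G - H) ^ 2) ^ 3) := by
  have h1 := sqrt_one_add_sq_pow_three_le (by linarith : 0 ≤ G + H)
  rw [show (-G - H) ^ 2 = (G + H) ^ 2 from by ring]
  have h2 := mul_le_mul_of_nonneg_left h1 hχ
  have hcube : 0 ≤ (G + H) ^ 3 := by positivity
  have h3 : H ^ 3 ≤ (G + H) ^ 3 := pow_le_pow_left₀ hH.le (by linarith) 3
  have h4 : 1 / 2 * ((G + H) + (G + H) ^ 3) ≤ τ * ((G + H) + (G + H) ^ 3) :=
    mul_le_mul_of_nonneg_right hτ (by positivity)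
  have h5 : χ * (G + H) ^ 3 ≤ 1 / 16 * (G + H) ^ 3 := mul_le_mul_of_nonneg_right hχ' hcube
  -- The terms `2χ` and `G / 2` cancel and the cube keeps the coefficient `1/2 - 2/16 = 3/8`; what
  -- remains is `H / 2 - (H + H²) / 4 + (3/8) H³`, whose quadratic factor has negative discriminant.
  have h6 : 0 < H * (1 / 4 - H / 4 + 3 / 8 * H ^ 2) :=
    mul_pos hH (by nlinarith [sq_nonneg (H - 1 / 3)])
  have h7 : τ * ((-G - H) + (-G - H) ^ 3) = -(τ * ((G + H) + (G + H) ^ 3)) := by ring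
  rw [h7]
  nlinarith

/-- One-dimensional profile of the barrier: positive, blowing up at `1`, bounded at `2` and beyond
uniformly in the translation `s`. -/
theorem exists_barrier_profile {χ : ℝ → ℝ} (hχ : Continuous χ) (hχ0 : ∀ y, 0 ≤ χ y)
    (hχ1 : ∀ y, χ y ≤ 1 / 16) (hχi : MeasureTheory.Integrable χ) :
    ∃ C : ℝ, ∀ s : ℝ, ∃ ψ ψ₁ ψ₂ : ℝ → ℝ,
      (∀ d, 1 < d → HasDerivAt ψ (ψ₁ d) d ∧ HasDerivAt ψ₁ (ψ₂ d) d ∧ ContDiffAt ℝ 2 ψ d ∧ 0 < ψ d) ∧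
      (∀ d, 2 ≤ d → ψ d ≤ C) ∧
      (∀ K : ℝ, ∃ d₁, 1 < d₁ ∧ ∀ d, 1 < d → d ≤ d₁ → K ≤ ψ d) ∧
      ∀ d, 1 < d → ∀ τ, 1 / 2 ≤ τ →
        ψ₂ d + τ * (ψ₁ d + ψ₁ d ^ 3) < -(χ (d - s) * √(1 + ψ₁ d ^ 2) ^ 3) := by
  set I := ∫ y, χ y with hI
  -- The logarithmic term decreases in `d`, so its value at `2` is the worst; the corrector
  -- contributes `4 I - B ≤ 4 I`.
  refine ⟨4 * I + -4 * Real.log (1 - Real.exp (-(2 - 1) / 4)), fun s => ?_⟩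
  obtain ⟨B, G, hB, hG, hBG⟩ := exists_bounded_corrector (g := fun d => χ (d - s))
    (by fun_prop) (fun y => hχ0 _) (hχi.comp_sub_right s)
  rw [MeasureTheory.integral_sub_right_eq_self (μ := MeasureTheory.volume) χ s] at hBG
  have hexp : ∀ d : ℝ, 1 < d → Real.exp (-(d - 1) / 4) < 1 := fun d hd => by
    have := Real.exp_lt_exp.2 (show -(d - 1) / 4 < 0 by linarith)
    rwa [Real.exp_zero] at this
  have hexpd : ∀ d : ℝ, HasDerivAt (fun t => Real.exp (-(t - 1) / 4))
      (-(Real.exp (-(d - 1) / 4)) / 4) d := fun d => by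
    have := (Real.hasDerivAt_exp (-(d - 1) / 4)).comp d
      ((((hasDerivAt_id d).sub_const 1).neg).div_const 4)
    refine this.congr_deriv ?_
    ring
  -- `-H` is the derivative of the logarithmic term. The rate `1/4` is slow enough for the linear
  -- part of `-H'` to be absorbed by the curvature term.
  set H : ℝ → ℝ := fun d => Real.exp (-(d - 1) / 4) / (1 - Real.exp (-(d - 1) / 4)) with hH
  have hHpos : ∀ d, 1 < d → 0 < H d := fun d hd =>
    div_pos (Real.exp_pos _) (by linarith [hexp d hd])
  have hHd : ∀ d, 1 < d → HasDerivAt H (-(H d + H d ^ 2) / 4) d := fun d hd => by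
    have hne : 1 - Real.exp (-(d - 1) / 4) ≠ 0 := by linarith [hexp d hd]
    refine ((hexpd d).div ((hexpd d).const_sub 1) hne).congr_deriv ?_
    simp only [hH]
    generalize Real.exp (-(d - 1) / 4) = e at *
    field_simp
    ring
  have hLd : ∀ d, 1 < d → HasDerivAt (fun t => -4 * Real.log (1 - Real.exp (-(t - 1) / 4)))
      (-H d) d := fun d hd => by
    have hne : 1 - Real.exp (-(d - 1) / 4) ≠ 0 := by linarith [hexp d hd]
    refine ((((hexpd d).const_sub 1).log hne).const_mul (-4)).congr_deriv ?_
    simp only [hH]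
    ring
  have hLpos : ∀ d, 1 < d → 0 < -4 * Real.log (1 - Real.exp (-(d - 1) / 4)) := fun d hd => by
    have := Real.log_neg (x := 1 - Real.exp (-(d - 1) / 4)) (by linarith [hexp d hd])
      (by linarith [Real.exp_pos (-(d - 1) / 4)])
    linarith
  refine ⟨fun d => 4 * I - B d + -4 * Real.log (1 - Real.exp (-(d - 1) / 4)),
    fun d => -G d - H d, fun d => -(-G d / 2 + 2 * χ (d - s)) + (H d + H d ^ 2) / 4,
    fun d hd => ⟨?_, ?_, ?_, ?_⟩, fun d hd => ?_, fun K => ?_, fun d hd τ hτ => ?_⟩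
  · exact (((hB d).const_sub (4 * I)).add (hLd d hd)).congr_deriv (by ring)
  · exact ((hG d).neg.sub (hHd d hd)).congr_deriv (by ring)
  · have hGc : Continuous G := continuous_iff_continuousAt.2 fun d => (hG d).continuousAt
    have hBc : ContDiff ℝ 2 B := contDiff_two_of_hasDerivAt hB hG (by fun_prop)
    have hne : 1 - Real.exp (-(d - 1) / 4) ≠ 0 := by linarith [hexp d hd]
    have hc : ContDiff ℝ 2 fun t : ℝ => 1 - Real.exp (-(t - 1) / 4) := by fun_prop
    exact (contDiffAt_const.sub hBc.contDiffAt).add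
      (contDiffAt_const.mul (hc.contDiffAt.log hne))
  · have := hLpos d hd
    have := (hBG d hd.le).2.2
    simp only
    linarith
  · have := (hBG d (by linarith)).2.1
    have h1 : Real.exp (-(d - 1) / 4) ≤ Real.exp (-(2 - 1) / 4) := Real.exp_le_exp.2 (by linarith)
    have h2 := hexp 2 (by norm_num)
    have h3 := Real.log_le_log (x := 1 - Real.exp (-(2 - 1) / 4))
      (y := 1 - Real.exp (-(d - 1) / 4)) (by linarith) (by linarith)
    simp only
    linarith
  · have hpos : 0 < Real.exp (-(|K| + 1) / 4) := Real.exp_pos _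
    -- From `1 - exp (-z) ≤ z` with `z = (d - 1) / 4`, the logarithmic term is at least `|K| + 1`.
    refine ⟨1 + 4 * Real.exp (-(|K| + 1) / 4), by linarith, fun d hd hd1 => ?_⟩
    have h1 := Real.add_one_le_exp (-(d - 1) / 4)
    have h2 := Real.log_le_log (x := 1 - Real.exp (-(d - 1) / 4)) (y := Real.exp (-(|K| + 1) / 4))
      (by linarith [hexp d hd]) (by linarith)
    rw [Real.log_exp] at h2
    have := (hBG d hd.le).2.2
    have := le_abs_self K
    simp only
    linarith
  · exact barrier_ineq (hBG d hd.le).1 (hHpos d hd) (hχ0 _) (hχ1 _) hτ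

/-! ### `Q` in the distance variable, and distance estimates. -/

/-- `Q` on functions of the signed distance `d` to a totally geodesic hyperplane, in terms of `d`. -/
theorem Q_comp_arsinh_planeSinh (s : ℝ) {p : EuclideanSpace ℝ (Fin n)} (hp : ‖p‖ = 1)
    {x : EuclideanSpace ℝ (Fin n)} (hx : x ∈ space n) {ψ ψ₁ : ℝ → ℝ} {c : ℝ}
    (hψc : ContDiffAt ℝ 2 ψ (Real.arsinh (planeSinh s p x)))
    (hψ : ∀ᶠ d in nhds (Real.arsinh (planeSinh s p x)), HasDerivAt ψ (ψ₁ d) d)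
    (hψ₁ : HasDerivAt ψ₁ c (Real.arsinh (planeSinh s p x))) :
    Q (fun y => ψ (Real.arsinh (planeSinh s p y))) x =
      -((√(1 + ψ₁ (Real.arsinh (planeSinh s p x)) ^ 2) ^ 3)⁻¹ *
        (c + (n - 1) * Real.tanh (Real.arsinh (planeSinh s p x)) *
          (ψ₁ (Real.arsinh (planeSinh s p x)) + ψ₁ (Real.arsinh (planeSinh s p x)) ^ 3))) := by
  have hF := (Real.hasDerivAt_arsinh (planeSinh s p x)).continuousAt.eventually hψ
  have hpos : 0 < 1 + planeSinh s p x ^ 2 := by positivity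
  have hr : 0 < √(1 + planeSinh s p x ^ 2) := Real.sqrt_pos.2 hpos
  have hsq : √(1 + planeSinh s p x ^ 2) ^ 2 = 1 + planeSinh s p x ^ 2 := Real.sq_sqrt hpos.le
  have hF1 := (hψ₁.comp _ (Real.hasDerivAt_arsinh (planeSinh s p x))).mul
    (((((hasDerivAt_id (planeSinh s p x)).pow 2).const_add 1).sqrt hpos.ne').inv hr.ne')
  have := Q_comp_planeSinh s hp hx (F := fun z => ψ (Real.arsinh z))
    (F1 := fun z => ψ₁ (Real.arsinh z) * (√(1 + z ^ 2))⁻¹)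
    (hψc.comp _ Real.contDiff_arsinh.contDiffAt)
    (hF.mono fun z hz => hz.comp z (Real.hasDerivAt_arsinh z)) hF1
  rw [this, Real.tanh_eq_sinh_div_cosh, Real.sinh_arsinh, Real.cosh_arsinh]
  simp only [Function.comp_apply, Pi.inv_apply, Pi.pow_apply, id]
  generalize planeSinh s p x = σ at *
  generalize ψ₁ (Real.arsinh σ) = q
  generalize √(1 + σ ^ 2) = r at *
  rw [← hsq]
  have e : 1 + (q * r⁻¹) ^ 2 * r ^ 2 = 1 + q ^ 2 := by field_simp
  rw [e]
  congr 2
  simp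
  field_simp
  ring

theorem mem_space {x : EuclideanSpace ℝ (Fin n)} : x ∈ space n ↔ ‖x‖ < 1 := by simp [space]

theorem one_sub_norm_sq_pos {x : EuclideanSpace ℝ (Fin n)} (hx : x ∈ space n) :
    0 < 1 - ‖x‖ ^ 2 := by
  have := mem_space.1 hx
  nlinarith [norm_nonneg x]

/-- The hyperbolic distance to the centre of the ball. -/
noncomputable def centreDist (x : EuclideanSpace ℝ (Fin n)) : ℝ :=
  Real.arsinh (conformalFactor x * ‖x‖)

theorem cosh_centreDist {x : EuclideanSpace ℝ (Fin n)} (hx : x ∈ space n) :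
    Real.cosh (centreDist x) = conformalFactor x - 1 := by
  have h := one_sub_norm_sq_pos hx
  have hl : conformalFactor x * (1 - ‖x‖ ^ 2) = 2 := by
    unfold conformalFactor; field_simp
  have hl1 : 0 ≤ conformalFactor x - 1 := by
    have := conformalFactor_pos hx
    nlinarith [sq_nonneg ‖x‖]
  rw [centreDist, Real.cosh_arsinh, ← Real.sqrt_sq hl1]
  congr 1
  linear_combination (-conformalFactor x) * hl

/-- The signed distances of `0` and `x` to a hyperplane differ by at most `d(0, x)`. -/
theorem abs_arsinh_planeSinh_sub_le (s : ℝ) {p : EuclideanSpace ℝ (Fin n)} (hp : ‖p‖ = 1)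
    {x : EuclideanSpace ℝ (Fin n)} (hx : x ∈ space n) :
    |Real.arsinh (planeSinh s p x) - s| ≤ centreDist x := by
  have hc := cosh_centreDist hx
  have hs : Real.sinh (centreDist x) = conformalFactor x * ‖x‖ := Real.sinh_arsinh _
  have hl := conformalFactor_pos hx
  have hin : |inner ℝ p x| ≤ ‖x‖ := by simpa [hp] using abs_real_inner_le_norm p x
  obtain ⟨h1, h2⟩ := abs_le.1 hin
  have hcs := (mul_pos hl (Real.cosh_pos s)).le
  have h3 := mul_le_mul_of_nonneg_left h1 hcs
  have h4 := mul_le_mul_of_nonneg_left h2 hcs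
  rw [abs_le]
  constructor
  -- The addition formula for `sinh` gives the formula of `planeSinh` with `⟨p, x⟩` replaced by its
  -- extreme value `‖x‖`.
  · have : Real.arsinh (Real.sinh (s - centreDist x)) ≤ Real.arsinh (planeSinh s p x) := by
      rw [Real.arsinh_le_arsinh, Real.sinh_sub, hc, hs, planeSinh]
      linarith
    rw [Real.arsinh_sinh] at this
    linarith
  · have : Real.arsinh (planeSinh s p x) ≤ Real.arsinh (Real.sinh (s + centreDist x)) := by
      rw [Real.arsinh_le_arsinh, Real.sinh_add, hc, hs, planeSinh]
      linarith
    rw [Real.arsinh_sinh] at this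
    linarith

theorem log_two_mul_le_arsinh {z : ℝ} (hz : 0 < z) : Real.log (2 * z) ≤ Real.arsinh z := by
  rw [Real.arsinh]
  have : z ≤ √(1 + z ^ 2) := Real.le_sqrt_of_sq_le (by linarith)
  exact Real.log_le_log (by linarith) (by linarith)

/-- Away from `o`, the distances to `o` and to the centre differ by a bounded amount. -/
theorem centreDist_le_hypDist_add {o : EuclideanSpace ℝ (Fin n)} (ho : o ∈ space n) {δ : ℝ}
    (hδ : 0 < δ) {x : EuclideanSpace ℝ (Fin n)} (hx : x ∈ space n) (hxo : δ ≤ ‖x - o‖) :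
    centreDist x ≤ hypDist x o - 2 * Real.log δ := by
  have ha := one_sub_norm_sq_pos hx
  have hb := one_sub_norm_sq_pos ho
  have hD : 0 < ‖x - o‖ := hδ.trans_le hxo
  have hx1 := mem_space.1 hx
  have hl := conformalFactor_pos hx
  -- Both distances are compared with `-log (1 - ‖x‖²)`, which then cancels.
  have h1 : centreDist x ≤ Real.log (2 * conformalFactor x) := by
    have hc := cosh_centreDist hx
    rw [centreDist, Real.cosh_arsinh] at hc
    have hle : conformalFactor x * ‖x‖ ≤ conformalFactor x * 1 :=
      mul_le_mul_of_nonneg_left hx1.le hl.le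
    have hexp : Real.exp (centreDist x) ≤ 2 * conformalFactor x := by
      rw [centreDist, Real.exp_arsinh, hc]
      linarith
    exact (Real.le_log_iff_exp_le (by positivity)).2 hexp
  have h2 : Real.log (2 * conformalFactor x) = 2 * Real.log 2 - Real.log (1 - ‖x‖ ^ 2) := by
    rw [conformalFactor, ← mul_div_assoc, Real.log_div (by norm_num) ha.ne',
      Real.log_mul (by norm_num) (by norm_num)]
    ring
  have h3 := log_two_mul_le_arsinh (z := ‖x - o‖ / √((1 - ‖x‖ ^ 2) * (1 - ‖o‖ ^ 2)))
    (by positivity)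
  rw [← mul_div_assoc, Real.log_div (by positivity) (by positivity),
    Real.log_mul (by norm_num) hD.ne', Real.log_sqrt (by positivity),
    Real.log_mul ha.ne' hb.ne'] at h3
  have h4 : Real.log (1 - ‖o‖ ^ 2) ≤ 0 := Real.log_nonpos hb.le (by nlinarith [sq_nonneg ‖o‖])
  have h5 := Real.log_le_log hδ hxo
  rw [hypDist]
  linarith

theorem half_le_tanh {d : ℝ} (hd : 1 ≤ d) : 1 / 2 ≤ Real.tanh d := by
  rw [Real.tanh_eq_sinh_div_cosh, div_le_div_iff₀ (by norm_num) (Real.cosh_pos d), Real.sinh_eq,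
    Real.cosh_eq]
  have h1 := Real.add_one_le_exp d
  have h2 : Real.exp d * Real.exp (-d) = 1 := by rw [← Real.exp_add]; simp
  have h3 := Real.exp_pos (-d)
  nlinarith

theorem planeSinh_eq_div (s : ℝ) (p : EuclideanSpace ℝ (Fin n)) {x : EuclideanSpace ℝ (Fin n)}
    (hx : x ∈ space n) : planeSinh s p x =
      (Real.sinh s * (1 + ‖x‖ ^ 2) - 2 * Real.cosh s * inner ℝ p x) / (1 - ‖x‖ ^ 2) := by
  have h := one_sub_norm_sq_pos hx
  rw [planeSinh, conformalFactor]
  field_simp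
  ring

/-! ### Comparison near one ideal point. -/

/-- Upper bound near an ideal point `p` at which `u` may be discontinuous, by comparison with
barriers that are infinite on hypersurfaces shrinking to `p`. -/
theorem exists_bound_near_ideal_point (hn : 2 ≤ n) {χ : ℝ → ℝ} (hχ : Continuous χ)
    (hχ0 : ∀ y, 0 ≤ χ y) (hχ1 : ∀ y, χ y ≤ 1 / 16) (hχi : MeasureTheory.Integrable χ) :
    ∃ C : ℝ, ∀ (p : EuclideanSpace ℝ (Fin n)) (δ M : ℝ) (u : EuclideanSpace ℝ (Fin n) → ℝ),
      ‖p‖ = 1 →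
      ContinuousOn u ((Metric.closedBall 0 1 ∩ Metric.closedBall p δ) \ {p}) →
      ContDiffOn ℝ 2 u (space n) →
      (∀ x ∈ space n, ‖x - p‖ < δ → ∀ s, Q u x ≤ χ (Real.arsinh (planeSinh s p x) - s)) →
      (∀ x, ‖x‖ ≤ 1 → ‖x - p‖ ≤ δ → x ≠ p → (‖x‖ = 1 ∨ ‖x - p‖ = δ) → u x ≤ M) →
      ∀ x ∈ space n, ‖x - p‖ ≤ δ → u x ≤ M + C := by
  obtain ⟨C, hC⟩ := exists_barrier_profile hχ hχ0 hχ1 hχi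
  refine ⟨C, fun p δ M u hp huc hu2 hQ hM x₀ hx₀ hx₀p => ?_⟩
  set s := centreDist x₀ + 2 with hs
  obtain ⟨ψ, ψ₁, ψ₂, hψ, hψC, hψK, hψQ⟩ := hC s
  set d : EuclideanSpace ℝ (Fin n) → ℝ := fun x => Real.arsinh (planeSinh s p x) with hd
  have hd₀ : 2 ≤ d x₀ := by
    have := (abs_le.1 (abs_arsinh_planeSinh_sub_le s hp hx₀)).1
    simp only [hd]
    linarith
  -- The region `d ≥ t`, with the denominator cleared so that it is closed up to the unit sphere.
  -- The point `p` is not in it, since `sinh s < cosh s`.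
  set A : ℝ → Set (EuclideanSpace ℝ (Fin n)) := fun t =>
    (Metric.closedBall 0 1 ∩ Metric.closedBall p δ) ∩
      {x | Real.sinh t * (1 - ‖x‖ ^ 2) ≤
        Real.sinh s * (1 + ‖x‖ ^ 2) - 2 * Real.cosh s * inner ℝ p x} with hA
  have hAcomp : ∀ t, IsCompact (A t) := fun t =>
    ((isCompact_closedBall 0 1).inter_right Metric.isClosed_closedBall).inter_right
      (isClosed_le (by fun_prop) (by fun_prop))
  have hAmem : ∀ t x, x ∈ space n → ‖x - p‖ ≤ δ → (x ∈ A t ↔ t ≤ d x) := fun t x hx hxp => by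
    have h1 : x ∈ Metric.closedBall (0 : EuclideanSpace ℝ (Fin n)) 1 ∩ Metric.closedBall p δ :=
      ⟨by simpa using (mem_space.1 hx).le, by simpa [dist_eq_norm] using hxp⟩
    have h2 : t ≤ d x ↔ Real.sinh t ≤ planeSinh s p x := by
      rw [← Real.sinh_le_sinh, Real.sinh_arsinh]
    rw [h2, planeSinh_eq_div s p hx, le_div_iff₀ (one_sub_norm_sq_pos hx)]
    exact ⟨fun h => h.2, fun h => ⟨h1, h⟩⟩
  have hAsub : ∀ t, A t ⊆ (Metric.closedBall 0 1 ∩ Metric.closedBall p δ) \ {p} := fun t x hx =>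
    ⟨hx.1, fun hxp => by
      have h := hx.2
      rw [mem_singleton_iff.1 hxp] at h
      simp only [mem_ofPred_eq, hp, real_inner_self_eq_norm_sq] at h
      have := Real.sinh_lt_cosh s
      linarith⟩
  by_contra! hcon
  -- `u` is bounded on `d ≥ 1` by a `U` depending on `s`; it serves only to choose `d₁` and does not
  -- enter the final constant.
  obtain ⟨U, hU⟩ := (hAcomp 1).bddAbove_image (huc.mono (hAsub 1))
  obtain ⟨d₁, hd₁, hblow⟩ := hψK (U - M)
  have hUle : ∀ x, x ∈ space n → ‖x - p‖ ≤ δ → 1 ≤ d x → u x ≤ U := fun x hx hxp hdx =>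
    hU (mem_image_of_mem u ((hAmem 1 x hx hxp).2 hdx))
  set η := u x₀ - M - ψ (d x₀) with hη
  have hη0 : 0 < η := by linarith [hψC _ hd₀]
  -- The cut `M + η ≤ u` removes the sphere and the boundary of the `δ`-ball, where `u ≤ M`. On `d =
  -- d₁` one has `u - ψ ≤ M`, so the maximum over `K` is a local one.
  set K := A d₁ ∩ {x | M + η ≤ u x} with hK
  have hKcomp : IsCompact K := by
    have : IsClosed (A d₁ ∩ u ⁻¹' Ici (M + η)) :=
      (huc.mono (hAsub d₁)).preimage_isClosed_of_isClosed (hAcomp d₁).isClosed isClosed_Ici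
    exact (hAcomp d₁).of_isClosed_subset this inter_subset_left
  have hKint : ∀ x ∈ K, x ∈ space n ∧ ‖x - p‖ < δ := fun x hx => by
    have h1 : ‖x‖ ≤ 1 := by simpa using hx.1.1.1
    have h2 : ‖x - p‖ ≤ δ := by simpa [dist_eq_norm] using hx.1.1.2
    have h3 : x ≠ p := (hAsub _ hx.1).2
    have h4 : M + η ≤ u x := hx.2
    have h5 : ¬(‖x‖ = 1 ∨ ‖x - p‖ = δ) := fun h => by linarith [hM x h1 h2 h3 h]
    push Not at h5
    exact ⟨mem_space.2 (lt_of_le_of_ne h1 h5.1), lt_of_le_of_ne h2 h5.2⟩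
  have hKd : ∀ x ∈ K, d₁ ≤ d x := fun x hx =>
    (hAmem d₁ x (hKint x hx).1 (hKint x hx).2.le).1 hx.1
  have hx₀K : x₀ ∈ K := by
    refine ⟨(hAmem d₁ x₀ hx₀ hx₀p).2 ?_, ?_⟩
    · by_contra! hlt
      have h1 := hblow (d x₀) (by linarith) hlt.le
      have h2 := hUle x₀ hx₀ hx₀p (by linarith)
      linarith
    · have := (hψ (d x₀) (by linarith)).2.2.2
      simp only [mem_ofPred_eq]
      linarith
  have hdC : ∀ x ∈ space n, ContDiffAt ℝ 2 d x := fun x hx =>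
    Real.contDiff_arsinh.contDiffAt.comp x (contDiffAt_planeSinh s p hx)
  have hwC : ∀ x ∈ space n, 1 < d x → ContDiffAt ℝ 2 (fun y => ψ (d y)) x := fun x hx hdx =>
    (hψ _ hdx).2.2.1.comp x (hdC x hx)
  have huC : ∀ x ∈ space n, ContDiffAt ℝ 2 u x := fun x hx =>
    hu2.contDiffAt (isOpen_space.mem_nhds hx)
  obtain ⟨x₁, hx₁, hmax⟩ := hKcomp.exists_isMaxOn (f := fun x => u x - ψ (d x)) ⟨x₀, hx₀K⟩
    fun x hx => ((huC x (hKint x hx).1).continuousAt.sub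
      (hwC x (hKint x hx).1 (hd₁.trans_le (hKd x hx))).continuousAt).continuousWithinAt
  obtain ⟨hx₁s, hx₁p⟩ := hKint x₁ hx₁
  have hge : M + η ≤ u x₁ - ψ (d x₁) := by
    have : u x₀ - ψ (d x₀) ≤ u x₁ - ψ (d x₁) := hmax hx₀K
    linarith
  have hd1x : d₁ ≤ d x₁ := hKd x₁ hx₁
  have hdx₁ : 1 < d x₁ := hd₁.trans_le hd1x
  have hdlt : d₁ < d x₁ := by
    refine lt_of_le_of_ne hd1x fun h => ?_
    have h1 := hblow (d x₁) hdx₁ h.ge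
    have h2 := hUle x₁ hx₁s hx₁p.le hdx₁.le
    linarith
  have hlocal : IsLocalMax (fun y => u y - ψ (d y)) x₁ := by
    have e1 : ∀ᶠ y in nhds x₁, y ∈ space n := isOpen_space.mem_nhds hx₁s
    have e2 : ∀ᶠ y in nhds x₁, ‖y - p‖ < δ :=
      (by fun_prop : Continuous fun y => ‖y - p‖).continuousAt.eventually_lt continuousAt_const hx₁p
    have e3 : ∀ᶠ y in nhds x₁, d₁ < d y :=
      continuousAt_const.eventually_lt (hdC x₁ hx₁s).continuousAt hdlt
    have e4 : ∀ᶠ y in nhds x₁, M + η < u y :=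
      continuousAt_const.eventually_lt (huC x₁ hx₁s).continuousAt
        (by linarith [(hψ _ hdx₁).2.2.2])
    filter_upwards [e1, e2, e3, e4] with y h1 h2 h3 h4
    exact hmax ⟨(hAmem d₁ y h1 h2.le).2 h3.le, h4.le⟩
  have hle := Q_le_of_isLocalMax_sub hx₁s (huC x₁ hx₁s) (hwC x₁ hx₁s hdx₁) hlocal
  have hQu := hQ x₁ hx₁s hx₁p s
  have hψev : ∀ᶠ t in nhds (d x₁), HasDerivAt ψ (ψ₁ t) t :=
    (lt_mem_nhds hdx₁).mono fun t ht => (hψ t ht).1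
  have hQw := Q_comp_arsinh_planeSinh s hp hx₁s (hψ _ hdx₁).2.2.1 hψev (hψ _ hdx₁).2.1
  change Q (fun y => ψ (d y)) x₁ = -((√(1 + ψ₁ (d x₁) ^ 2) ^ 3)⁻¹ * (ψ₂ (d x₁) +
    (n - 1) * Real.tanh (d x₁) * (ψ₁ (d x₁) + ψ₁ (d x₁) ^ 3))) at hQw
  change Q u x₁ ≤ χ (d x₁ - s) at hQu
  have hn1 : (1 : ℝ) ≤ n - 1 := by
    have : (2 : ℝ) ≤ n := by exact_mod_cast hn
    linarith
  have hτ : 1 / 2 ≤ ((n : ℝ) - 1) * Real.tanh (d x₁) := by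
    have := half_le_tanh hdx₁.le
    nlinarith
  have hstrict := hψQ (d x₁) hdx₁ _ hτ
  have hW : 0 < √(1 + ψ₁ (d x₁) ^ 2) ^ 3 := by positivity
  have h1 := mul_lt_mul_of_pos_left hstrict (inv_pos.2 hW)
  have h2 : (√(1 + ψ₁ (d x₁) ^ 2) ^ 3)⁻¹ * -(χ (d x₁ - s) * √(1 + ψ₁ (d x₁) ^ 2) ^ 3) =
      -χ (d x₁ - s) := by
    field_simp
  linarith

/-! ### An integrable majorant of `f` near infinity. -/

theorem exists_le_of_integrableOn_Ici {χ : ℝ → ℝ}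
    (hχi : MeasureTheory.IntegrableOn χ (Ici 0)) {ε : ℝ} (hε : 0 < ε) : ∃ R, 0 ≤ R ∧ χ R ≤ ε := by
  by_contra! h
  have h1 : MeasureTheory.IntegrableOn (fun _ : ℝ => ε) (Ici 0) := by
    refine MeasureTheory.Integrable.mono' hχi MeasureTheory.aestronglyMeasurable_const ?_
    filter_upwards [MeasureTheory.ae_restrict_mem measurableSet_Ici] with r hr
    rw [Real.norm_of_nonneg hε.le]
    exact (h r hr).le
  rw [MeasureTheory.integrableOn_const_iff] at h1
  simp [hε.ne'] at h1

/-- Truncating and shifting an integrable monotone function of `|y|` keeps it integrable. -/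
theorem integrable_comp_max_abs_sub {χ : ℝ → ℝ} (hχc : ContinuousOn χ (Ici 0))
    (hχ0 : ∀ r, 0 ≤ χ r) (hχa : AntitoneOn χ (Ici 0))
    (hχi : MeasureTheory.IntegrableOn χ (Ici 0)) {R : ℝ} (hR : 0 ≤ R) (c : ℝ) :
    Continuous (fun y => χ (max R (|y| - c))) ∧
      MeasureTheory.Integrable fun y => χ (max R (|y| - c)) := by
  have hcont : Continuous (fun y => χ (max R (|y| - c))) :=
    hχc.comp_continuous (by fun_prop) fun y => hR.trans (le_max_left _ _)
  refine ⟨hcont, ?_⟩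
  set k : ℝ → ℝ := (Ici 0).indicator χ with hk
  have hki : MeasureTheory.Integrable k := hχi.integrable_indicator measurableSet_Ici
  have hk0 : ∀ y, 0 ≤ k y := fun y => indicator_nonneg (fun r _ => hχ0 r) y
  have hkeq : ∀ y, 0 ≤ y → k y = χ y := fun y hy => indicator_of_mem hy χ
  -- Outside `[-T, T]` the maximum is `|y| - c`, and one of the two translates of `k` dominates;
  -- inside, the constant `χ R` does.
  set T : ℝ := max 0 (R + c) + |c| with hT
  have hb : MeasureTheory.Integrable ((Icc (-T) T).indicator fun _ => χ R) :=
    (MeasureTheory.integrable_indicator_iff measurableSet_Icc).2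
      (MeasureTheory.integrableOn_const (by simp))
  have hb0 : ∀ y, 0 ≤ (Icc (-T) T).indicator (fun _ => χ R) y := fun y =>
    indicator_nonneg (fun _ _ => hχ0 R) y
  have hi1 : MeasureTheory.Integrable fun y => k (y - c) := hki.comp_sub_right c
  have hi2 : MeasureTheory.Integrable fun y => k (-y - c) :=
    (hki.comp_sub_right c).comp_neg
  refine ((hi1.add hi2).add hb).mono' hcont.aestronglyMeasurable
    (Filter.Eventually.of_forall fun y => ?_)
  rw [Real.norm_of_nonneg (hχ0 _)]
  simp only [Pi.add_apply]
  have h1 := hk0 (y - c)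
  have h2 := hk0 (-y - c)
  have h3 := hb0 y
  by_cases hy : |y| ≤ T
  · have h4 : (Icc (-T) T).indicator (fun _ => χ R) y = χ R :=
      indicator_of_mem (mem_Icc.2 (abs_le.1 hy)) _
    have h5 : χ (max R (|y| - c)) ≤ χ R := hχa hR (hR.trans (le_max_left _ _)) (le_max_left _ _)
    linarith
  · have h4 : R ≤ |y| - c := by
      have := le_max_right 0 (R + c)
      have := abs_nonneg c
      linarith
    rw [max_eq_right h4]
    rcases abs_cases y with ⟨h, _⟩ | ⟨h, _⟩
    · rw [h] at h4 ⊢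
      linarith [hkeq _ (hR.trans h4)]
    · rw [h] at h4 ⊢
      linarith [hkeq _ (hR.trans h4)]

theorem exists_centreDist_ge (K : ℝ) :
    ∃ η > 0, ∀ x ∈ space n, 1 - η < ‖x‖ → K ≤ centreDist x := by
  have hpos := Real.exp_pos K
  refine ⟨min (1 / 2) (1 / (2 * Real.exp K)), by positivity, fun x hx hxη => ?_⟩
  have h1 := one_sub_norm_sq_pos hx
  have hx1 := mem_space.1 hx
  have h2 : 1 / 2 < ‖x‖ := by
    have := min_le_left (1 / 2) (1 / (2 * Real.exp K))
    linarith
  have h3 : 1 - ‖x‖ < 1 / (2 * Real.exp K) := by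
    have := min_le_right (1 / 2) (1 / (2 * Real.exp K))
    linarith
  rw [lt_div_iff₀ (by positivity)] at h3
  have h4 : Real.exp K * (1 - ‖x‖ ^ 2) ≤ 1 := by
    have : 1 - ‖x‖ ^ 2 ≤ 2 * (1 - ‖x‖) := by nlinarith
    nlinarith
  have h5 : Real.exp K ≤ conformalFactor x * ‖x‖ := by
    rw [conformalFactor, div_mul_eq_mul_div, le_div_iff₀ h1]
    linarith
  have h6 : Real.sinh K ≤ Real.exp K := by
    rw [Real.sinh_eq]
    linarith [Real.exp_pos (-K)]
  rw [← Real.arsinh_sinh K, centreDist, Real.arsinh_le_arsinh]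
  exact h6.trans h5

/-- Near the asymptotic boundary `f` is dominated by a small integrable function of any quantity
bounded by the distance to the centre. -/
theorem RadialDecay.exists_majorant {f : EuclideanSpace ℝ (Fin n) → ℝ → ℝ} (hf : RadialDecay f) :
    ∃ χ : ℝ → ℝ, Continuous χ ∧ (∀ y, 0 ≤ χ y) ∧ (∀ y, χ y ≤ 1 / 16) ∧
      MeasureTheory.Integrable χ ∧ ∃ η > 0, ∀ x ∈ space n, 1 - η < ‖x‖ → ∀ t y : ℝ,
        |y| ≤ centreDist x → |f x t| ≤ χ y := by
  obtain ⟨o, ho, ϕ, hϕc, hϕa, hϕ, hϕi⟩ := hf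
  have hχ0 : ∀ r, 0 ≤ √(ϕ r) := fun r => Real.sqrt_nonneg _
  have hχa : AntitoneOn (fun r => √(ϕ r)) (Ici 0) := fun a ha b hb hab =>
    Real.sqrt_le_sqrt (hϕa ha hb hab)
  obtain ⟨R, hR, hχR⟩ := exists_le_of_integrableOn_Ici hϕi (by norm_num : (0 : ℝ) < 1 / 16)
  have ho1 := mem_space.1 ho
  set δ := (1 - ‖o‖) / 2 with hδ
  have hδ0 : 0 < δ := by linarith
  -- The loss in passing from the base point `o` to the centre.
  set c := -(2 * Real.log δ) with hc
  obtain ⟨hcont, hint⟩ := integrable_comp_max_abs_sub hϕc.sqrt hχ0 hχa hϕi hR c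
  obtain ⟨η, hη, hηK⟩ := exists_centreDist_ge (n := n) (R + c)
  have hle : ∀ y, √(ϕ (max R (|y| - c))) ≤ √(ϕ R) := fun y =>
    hχa hR (hR.trans (le_max_left _ _)) (le_max_left _ _)
  refine ⟨_, hcont, fun y => hχ0 _, fun y => (hle y).trans hχR, hint, min η δ,
    lt_min hη hδ0, fun x hx hxη t y hy => ?_⟩
  have h1 := hηK x hx (by linarith [min_le_left η δ])
  have h2 : δ ≤ ‖x - o‖ := by
    have := norm_sub_norm_le x o
    have := min_le_right η δ
    linarith
  have h3 := centreDist_le_hypDist_add ho hδ0 hx h2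
  have h4 : max R (|y| - c) ≤ hypDist x o := max_le (by linarith) (by linarith)
  have h5 : √(ϕ (hypDist x o)) ≤ √(ϕ (max R (|y| - c))) :=
    hχa (hR.trans (le_max_left _ _)) ((hR.trans (le_max_left _ _)).trans h4) h4
  have h6 := hϕ x hx t
  have h7 : √(ϕ (hypDist x o)) ^ 2 = ϕ (hypDist x o) := Real.sq_sqrt ((abs_nonneg _).trans h6)
  have h8 := hχ0 (hypDist x o)
  have h9 := hle y
  -- `ϕ = (√ϕ)² ≤ √ϕ`, because `√ϕ ≤ 1/16` here.
  nlinarith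

end Hyperbolic

/-! ### The global bound. -/

theorem proposition4 (n : ℕ) (hn : 2 ≤ n)
    (f : EuclideanSpace ℝ (Fin n) → ℝ → ℝ)
    (hf : ContDiffOn ℝ 1 (fun q : EuclideanSpace ℝ (Fin n) × ℝ => f q.1 q.2)
      (Hyperbolic.space n ×ˢ (Set.univ : Set ℝ)))
    (hft : ∀ x ∈ Hyperbolic.space n, ∀ t : ℝ, deriv (fun s => f x s) t ≤ 0)
    (hf₁ : Hyperbolic.RadialDecay f)
    (hf₂ : Hyperbolic.HeightDecay f)
    (φ : EuclideanSpace ℝ (Fin n) → ℝ)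
    (hφ : ContinuousOn φ (Hyperbolic.asymptoticBoundary n))
    (k : ℕ) (p : Fin k → EuclideanSpace ℝ (Fin n))
    (hp : ∀ i, p i ∈ Hyperbolic.asymptoticBoundary n)
    (u : EuclideanSpace ℝ (Fin n) → ℝ)
    (hu₂ : ContDiffOn ℝ 2 u (Hyperbolic.space n))
    (hu₀ : ContinuousOn u (Hyperbolic.compactification n \ Set.range p))
    (hQ : ∀ x ∈ Hyperbolic.space n, Hyperbolic.Q u x = f x (u x))
    (huφ : ∀ x ∈ Hyperbolic.asymptoticBoundary n \ Set.range p, u x = φ x) :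
    ∃ C : ℝ, ∀ x ∈ Hyperbolic.compactification n \ Set.range p, |u x| ≤ C := by
  obtain ⟨χ, hχc, hχ0, hχ1, hχi, η, hη, hfχ⟩ := hf₁.exists_majorant
  obtain ⟨C, hC⟩ := Hyperbolic.exists_bound_near_ideal_point hn hχc hχ0 hχ1 hχi
  have hp1 : ∀ i, ‖p i‖ = 1 := fun i => by simpa [Hyperbolic.asymptoticBoundary] using hp i
  -- The factor `2` makes closed `δ`-balls at distinct points disjoint, and `δ < η` keeps them where
  -- the majorant applies.
  obtain ⟨δ, hδsep, hδη, hδ0⟩ : ∃ δ : ℝ, (∀ i j, p i ≠ p j → 2 * δ < ‖p i - p j‖) ∧ δ < η ∧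
      0 < δ := by
    have h1 : ∀ᶠ δ in nhdsWithin (0 : ℝ) (Ioi 0), ∀ i j, p i ≠ p j → 2 * δ < ‖p i - p j‖ := by
      refine Filter.eventually_all.2 fun i => Filter.eventually_all.2 fun j => ?_
      by_cases hij : p i = p j
      · simp [hij]
      · have hpos : 0 < ‖p i - p j‖ := norm_pos_iff.2 (sub_ne_zero.2 hij)
        have hev : ∀ᶠ δ in nhds (0 : ℝ), δ < ‖p i - p j‖ / 2 := gt_mem_nhds (by positivity)
        filter_upwards [hev.filter_mono nhdsWithin_le_nhds] with δ hδ _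
        linarith
    have h2 : ∀ᶠ δ in nhdsWithin (0 : ℝ) (Ioi 0), δ < η :=
      Filter.Eventually.filter_mono nhdsWithin_le_nhds (gt_mem_nhds hη)
    have h3 : ∀ᶠ δ in nhdsWithin (0 : ℝ) (Ioi 0), 0 < δ := self_mem_nhdsWithin
    exact (h1.and (h2.and h3)).exists
  set K : Set (EuclideanSpace ℝ (Fin n)) :=
    Metric.closedBall 0 1 \ ⋃ i, Metric.ball (p i) δ with hK
  have hKsub : K ⊆ Hyperbolic.compactification n \ Set.range p := fun x hx =>
    ⟨hx.1, fun ⟨i, hi⟩ => hx.2 (mem_iUnion.2 ⟨i, by simp [hi, hδ0]⟩)⟩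
  have hKcomp : IsCompact K :=
    (isCompact_closedBall 0 1).diff (isOpen_iUnion fun i => Metric.isOpen_ball)
  obtain ⟨M₁, hM₁⟩ := hKcomp.exists_bound_of_continuousOn (hu₀.mono hKsub)
  obtain ⟨M₂, hM₂⟩ := (isCompact_sphere (0 : EuclideanSpace ℝ (Fin n)) 1).exists_bound_of_continuousOn
    hφ
  set M := max M₁ M₂ with hM
  have hsphere : ∀ x, ‖x‖ = 1 → x ∉ Set.range p → |u x| ≤ M := fun x hx hxp => by
    have hmem : x ∈ Hyperbolic.asymptoticBoundary n := by simpa [Hyperbolic.asymptoticBoundary]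
    rw [huφ x ⟨hmem, hxp⟩]
    exact (hM₂ x hmem).trans (le_max_right _ _)
  have hKM : ∀ x ∈ K, |u x| ≤ M := fun x hx => (hM₁ x hx).trans (le_max_left _ _)
  have hnot : ∀ i x, ‖x - p i‖ ≤ δ → x ≠ p i → x ∉ Set.range p := fun i x hx hne ⟨j, hj⟩ => by
    subst hj
    linarith [hδsep j i hne]
  have hbd : ∀ i x, ‖x‖ ≤ 1 → ‖x - p i‖ ≤ δ → x ≠ p i → (‖x‖ = 1 ∨ ‖x - p i‖ = δ) → |u x| ≤ M := by
    rintro i x hx hxp hne (h | h)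
    · exact hsphere x h (hnot i x hxp hne)
    · refine hKM x ⟨by simpa using hx, fun hmem => ?_⟩
      obtain ⟨j, hj⟩ := mem_iUnion.1 hmem
      rw [Metric.mem_ball, dist_eq_norm] at hj
      by_cases hij : p j = p i
      · rw [hij] at hj; linarith
      · have h1 := hδsep j i hij
        have h2 : ‖p j - p i‖ ≤ ‖x - p i‖ + ‖x - p j‖ := by
          rw [show p j - p i = (x - p i) - (x - p j) from by abel]
          exact norm_sub_le _ _
        linarith
  have hcont : ∀ i, ContinuousOn u
      ((Metric.closedBall 0 1 ∩ Metric.closedBall (p i) δ) \ {p i}) := fun i =>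
    hu₀.mono fun x hx => ⟨hx.1.1, hnot i x (by simpa [dist_eq_norm] using hx.1.2) hx.2⟩
  have hfQ : ∀ i, ∀ x ∈ Hyperbolic.space n, ‖x - p i‖ < δ → ∀ s, |Hyperbolic.Q u x| ≤
      χ (Real.arsinh (Hyperbolic.planeSinh s (p i) x) - s) := fun i x hx hxp s => by
    rw [hQ x hx]
    refine hfχ x hx ?_ _ _ (Hyperbolic.abs_arsinh_planeSinh_sub_le s (hp1 i) hx)
    have := norm_sub_norm_le (p i) x
    rw [hp1, norm_sub_rev] at this
    linarith
  refine ⟨M + |C|, fun x hx => ?_⟩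
  have hCabs := le_abs_self C
  have hC0 := abs_nonneg C
  have hx1 : ‖x‖ ≤ 1 := by simpa [Hyperbolic.compactification] using hx.1
  rcases hx1.eq_or_lt with h1 | h1
  · linarith [hsphere x h1 hx.2]
  by_cases hxK : x ∈ K
  · linarith [hKM x hxK]
  obtain ⟨i, hi⟩ : ∃ i, x ∈ Metric.ball (p i) δ := by
    by_contra hcon
    exact hxK ⟨hx.1, fun h => hcon (mem_iUnion.1 h)⟩
  rw [Metric.mem_ball, dist_eq_norm] at hi
  have hxs := Hyperbolic.mem_space.2 h1
  have hup := hC (p i) δ M u (hp1 i) (hcont i) hu₂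
    (fun y hy hyp s => (le_abs_self _).trans (hfQ i y hy hyp s))
    (fun y h1 h2 h3 h4 => (le_abs_self _).trans (hbd i y h1 h2 h3 h4)) x hxs hi.le
  -- `Q` is odd and the majorant bounds `|f|`, so the same estimate applies to `-u`.
  have hlow := hC (p i) δ M (fun y => -u y) (hp1 i) (hcont i).neg hu₂.neg
    (fun y hy hyp s => by
      rw [Hyperbolic.Q_neg]
      exact (neg_le_abs _).trans (hfQ i y hy hyp s))
    (fun y h1 h2 h3 h4 => (neg_le_abs _).trans (hbd i y h1 h2 h3 h4)) x hxs hi.le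
  exact abs_le.2 ⟨by linarith, by linarith⟩
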